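/- Call a map $h:\Gamma^*\to\Gamma^*$ on finite words over a finite alphabet $\Gamma$ a morphism if $h(xy)=h(x)h(y)$ for all $x,y$; it is non-erasing if $h(a)\neq\varepsilon$ for every letter $a\in\Gamma$. For a tuple $(h_0,\dots,h_{p-1})$ of morphisms $\Gamma^*\to\Gamma^*$, $p\ge 1$, define $H:\Gamma^*\to\Gamma^*$ by $H(a_0a_1\cdots a_n)=u_0u_1\cdots u_n$, where $u_i=h_{k}(a_i)$ with $k\in\{0,\dots,p-1\}$ and $k\equiv i \pmod p$ (and $H(\varepsilon)=\varepsilon$). A PD0L system is a triple $(\Gamma,(h_0,\dots,h_{p-1}),s)$ with $s\in\Gamma^*$ a prefix of $H(s)$. An infinite word $\mathbf u\in\Gamma^{\mathbb N}$ is the PD0L word generated by this system if $\mathbf u=\lim_{n\to\infty}H^n(s)$, i.e. every finite prefix of $\mathbf u$ is a prefix of $H^n(s)$ for all sufficiently large $n$. **Theorem.** Let $\Sigma$ be a finite alphabet and let $\mathbf w\in\Sigma^{\mathbb N}$ be a computable infinite word. Then there exist a finite alphabet $\Gamma\supsetneq\Sigma$ and an infinite word $\mathbf u\in\Gamma^{\mathbb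 N}$ that is the PD0L word generated by a PD0L system over $\Gamma$ all of whose morphisms are non-erasing, such that $\mathbf w$ is sparsely embedded in $\mathbf u$; that is, $\mathbf w$ is exactly the infinite word obtained from $\mathbf u$ by erasing all letters in $\Gamma\setminus\Sigma$. -/

import Mathlib

/-- The map `H : Γ* → Γ*` of a `p`-tuple of morphisms `h₀, …, h_{p-1} : Γ* → Γ*`, each given by
its values on letters: `H (a₀ a₁ ⋯ aₙ) = u₀ u₁ ⋯ uₙ`, where `uᵢ = h_k (aᵢ)` with
`k ≡ i (mod p)`. (`Fin.ofNat p i` is `i` reduced modulo `p`.) -/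
def periodicMap {Γ : Type*} {p : ℕ} [NeZero p] (h : Fin p → Γ → List Γ) (x : List Γ) : List Γ :=
  (x.mapIdx fun i a => h (Fin.ofNat p i) a).flatten

/-- A PD0L system (D0L system with periodic control) over the alphabet `Γ`: a non-empty tuple of
morphisms together with a finite word `seed` that is a prefix of its image `H seed`. Morphisms are
allowed to be erasing here. -/
structure PD0LSystem (Γ : Type*) where
  /-- the number of morphisms -/
  period : ℕ
  [period_ne_zero : NeZero period]
  /-- the morphisms, given by their values on letters -/
  morphism : Fin period → Γ → List Γ
  /-- the starting word -/
  seed : List Γ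
  seed_prefix : seed <+: periodicMap morphism seed

namespace PD0LSystem

attribute [instance] PD0LSystem.period_ne_zero

variable {Γ : Type*}

/-- The system is non-erasing: no morphism sends a letter to the empty word. -/
def NonErasing (S : PD0LSystem Γ) : Prop :=
  ∀ (i : Fin S.period) (a : Γ), S.morphism i a ≠ []

/-- The finite word `H^n (seed)`. -/
def iter (S : PD0LSystem Γ) (n : ℕ) : List Γ :=
  (periodicMap S.morphism)^[n] S.seed

/-- The infinite word `u` is the PD0L word generated by `S`, that is, `u = lim H^n (seed)` for the
distance `2 ^ (-m)` with `m` the length of the longest common prefix: for every `N`, the prefix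
`u 0 ⋯ u (N - 1)` of `u` is a prefix of `H^n (seed)` for all sufficiently large `n`. -/
def Generates (S : PD0LSystem Γ) (u : ℕ → Γ) : Prop :=
  ∀ N : ℕ, ∀ᶠ n in Filter.atTop, (List.range N).map u <+: S.iter n

end PD0LSystem

/-- For alphabets `A ⊆ Γ` (the inclusion being `ι`), the infinite word `w` over `A` is sparsely
embedded in the infinite word `u` over `Γ`: erasing from `u` all letters outside `A` leaves exactly
`w`. Here `f 0 < f 1 < ⋯` enumerates precisely the positions of `u` that carry a letter of `A`. -/
def SparselyEmbedded {A Γ : Type*} (ι : A ↪ Γ) (w : ℕ → A) (u : ℕ → Γ) : Prop :=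
  ∃ f : ℕ → ℕ, StrictMono f ∧ Set.range f = {n | u n ∈ Set.range ι} ∧ ∀ n, u (f n) = ι (w n)

/-! In a PD0L system a letter is rewritten according to its position modulo `p`, and this position
serves as the state of a finite transducer. Each letter `x` is replaced by `code g k x`, that is,
`x` padded by copies of a neutral letter `g`. The padding can be chosen so that reading `x` moves
the position by any prescribed residue, its width. On code words the map `H` then acts as a
sequential transduction (`periodicMap_flatMap_code`). Every letter yields at least one pad, so the
morphisms are non-erasing even where the transduction outputs nothing.

If the first letter reproduces itself, each iterate extends the previous one by a new block, which
is the transduction of the preceding block (`transduce_iterate`). A block stores a configuration of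
a counter machine: counter values are numbers of `unit` letters, and a final control letter carries
the machine state as its width. Residues live in `ZMod S × ZMod b`: the first factor encodes the
machine state, the second counts units modulo `b`. Three successive blocks simulate one machine step
(`represents_step`). Output letters remain in the block where they appear and are dropped from the
next, so erasing the auxiliary letters leaves exactly the output of the machine
(`filterMap_iterate_transduce`).

It remains to produce `w` by a counter machine visiting finitely many states. The four stacks of the
machine in `Turing.PartrecToTM2` become counters in base 5. A code sending `[n]` to `[x n, n + 1]`,
with `x n` encoding `w n`, is run forever; each round emits one letter and leaves the next input on
the stack (`passes_round`). The entries `x n` are bounded in length since the alphabet is finite, so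
they can be decoded in finitely many states. -/

namespace PD0LSystem

/-! ### Periodic control as a sequential transduction on code words -/

section Coding

variable {X G : Type*} [Ring G] {p : ℕ} [NeZero p] (g : X) (k : X → ℕ) (δ : G → X → List X)

/-- The code word of a letter `x`: the letter followed by `k x` padding letters `g`. -/
def code (x : X) : List X := x :: List.replicate (k x) g

/-- The residue of the length of the code word of a letter. -/
def width (x : X) : G := ((k x + 1 : ℕ) : G)

/-- The sequential transduction with output function `δ`, whose state is moved by the widths of
the letters read; every letter of a code word also produces one padding letter. -/
def transduce : G → List X → List X
  | _, [] => []
  | s, x :: l => δ s x ++ List.replicate (k x + 1) g ++ transduce (s + width k x) l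

/-- The morphisms which realize a transduction on code words. -/
def codedMorphism (i : Fin p) (x : X) : List X :=
  (δ ((i : ℕ) : G) x ++ [g]).flatMap (code g k)

/-- The map of a tuple of morphisms applied to a factor that starts at position `n`. -/
def periodicMapFrom {Γ : Type*} (h : Fin p → Γ → List Γ) : ℕ → List Γ → List Γ
  | _, [] => []
  | n, a :: x => h (Fin.ofNat p n) a ++ periodicMapFrom h (n + 1) x

theorem periodicMap_eq {Γ : Type*} (h : Fin p → Γ → List Γ) (x : List Γ) :
    periodicMap h x = periodicMapFrom h 0 x := by
  have key : ∀ (x : List Γ) (n : ℕ),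
      (x.mapIdx fun i a => h (Fin.ofNat p (i + n)) a).flatten = periodicMapFrom h n x := by
    intro x
    induction x with
    | nil => intro n; simp [periodicMapFrom]
    | cons a x ih =>
      intro n
      rw [List.mapIdx_cons, List.flatten_cons, periodicMapFrom, ← ih (n + 1)]
      simp only [zero_add, add_assoc, add_comm 1 n]
  simpa [periodicMap] using key x 0

theorem periodicMapFrom_append {Γ : Type*} (h : Fin p → Γ → List Γ) (x y : List Γ) (n : ℕ) :
    periodicMapFrom h n (x ++ y) = periodicMapFrom h n x ++ periodicMapFrom h (n + x.length) y := by
  induction x generalizing n with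
  | nil => simp [periodicMapFrom]
  | cons a x ih =>
    simp only [List.cons_append, periodicMapFrom, ih, List.append_assoc, List.length_cons]
    congr 3
    omega

theorem transduce_append (s : G) (x y : List X) :
    transduce g k δ s (x ++ y) =
      transduce g k δ s x ++ transduce g k δ (s + (x.map (width k)).sum) y := by
  induction x generalizing s with
  | nil => simp [transduce]
  | cons a x ih => simp [transduce, ih, add_assoc]

variable {g k δ}

/-- Since `p` vanishes in `G`, the index of the morphism applied at position `n` determines the
transducer state `n : G`. -/
theorem natCast_ofNat (hp : (p : G) = 0) (n : ℕ) : (((Fin.ofNat p n : Fin p) : ℕ) : G) = n := by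
  conv_rhs => rw [← Nat.mod_add_div n p]
  simp [hp]

theorem periodicMapFrom_replicate (hδ : ∀ s, δ s g = []) (m n : ℕ) :
    periodicMapFrom (codedMorphism g k δ (p := p)) n (List.replicate m g) =
      (List.replicate m g).flatMap (code g k) := by
  induction m generalizing n with
  | zero => simp [periodicMapFrom]
  | succ m ih => simp [List.replicate_succ, periodicMapFrom, ih, codedMorphism, hδ]

/-- The code word of `x` has length `k x + 1`, so passing it advances the state by `width k x`. Its
leading letter and its `k x` pads contribute one coded pad each, whatever their positions, because
`δ s g` is empty. -/
theorem periodicMapFrom_flatMap_code (hp : (p : G) = 0) (hδ : ∀ s, δ s g = []) (l : List X)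
    (n : ℕ) :
    periodicMapFrom (codedMorphism g k δ (p := p)) n (l.flatMap (code g k)) =
      (transduce g k δ (n : G) l).flatMap (code g k) := by
  induction l generalizing n with
  | nil => simp [periodicMapFrom, transduce]
  | cons x l ih =>
    rw [List.flatMap_cons, periodicMapFrom_append, ih, transduce, code, periodicMapFrom,
      periodicMapFrom_replicate hδ, codedMorphism, natCast_ofNat hp]
    simp [List.replicate_succ, width]

theorem periodicMap_flatMap_code (hp : (p : G) = 0) (hδ : ∀ s, δ s g = []) (l : List X) :
    periodicMap (codedMorphism g k δ (p := p)) (l.flatMap (code g k)) =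
      (transduce g k δ 0 l).flatMap (code g k) := by
  rw [periodicMap_eq, periodicMapFrom_flatMap_code hp hδ, Nat.cast_zero]

/-- The system which realizes a transduction on code words, started with a letter `a` such that
`δ s a` always starts with `a`. -/
def coded (p : ℕ) [NeZero p] (hp : (p : G) = 0) (hδ : ∀ s, δ s g = []) (a : X) (r : List X)
    (ha : ∀ s, δ s a = a :: r) : PD0LSystem X where
  period := p
  morphism := codedMorphism g k δ
  seed := [a].flatMap (code g k)
  seed_prefix := by
    rw [periodicMap_flatMap_code hp hδ, transduce, ha]
    simp

theorem coded_nonErasing (hp : (p : G) = 0) (hδ : ∀ s, δ s g = []) (a : X) (r : List X)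
    (ha : ∀ s, δ s a = a :: r) : (coded (k := k) p hp hδ a r ha).NonErasing := by
  intro i x
  simp [coded, codedMorphism, code]

theorem coded_iter (hp : (p : G) = 0) (hδ : ∀ s, δ s g = []) (a : X) (r : List X)
    (ha : ∀ s, δ s a = a :: r) (n : ℕ) :
    (coded (k := k) p hp hδ a r ha).iter n =
      ((transduce g k δ 0)^[n] [a]).flatMap (code g k) := by
  induction n with
  | zero => rfl
  | succ n ih =>
    rw [iter] at ih ⊢
    rw [Function.iterate_succ_apply', ih, Function.iterate_succ_apply']
    exact periodicMap_flatMap_code hp hδ _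

/-- The blocks which successively extend the iterates of a transduction, with the states at which
they start. -/
def block (g : X) (k : X → ℕ) (δ : G → X → List X) (a : X) (r : List X) : ℕ → G × List X :=
  fun n => (fun c : G × List X => (c.1 + (c.2.map (width k)).sum, transduce g k δ c.1 c.2))^[n]
    (width k a, r ++ List.replicate (k a + 1) g)

/-- An old iterate followed by its last block is transduced piecewise: the old part yields the
current iterate, and the block is read in the state given by the total width before it. Both
conjuncts are needed together for the induction. -/
theorem transduce_iterate (a : X) (r : List X) (ha : ∀ s, δ s a = a :: r) (n : ℕ) :
    (transduce g k δ 0)^[n + 1] [a] = (transduce g k δ 0)^[n] [a] ++ (block g k δ a r n).2 ∧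
      (((transduce g k δ 0)^[n] [a]).map (width k)).sum = (block g k δ a r n).1 := by
  induction n with
  | zero => simp [transduce, ha, block]
  | succ n ih =>
    have hb : block g k δ a r (n + 1) = ((block g k δ a r n).1 +
        ((block g k δ a r n).2.map (width k)).sum,
          transduce g k δ (block g k δ a r n).1 (block g k δ a r n).2) := by
      rw [block, Function.iterate_succ_apply']
      rfl
    constructor
    · rw [Function.iterate_succ_apply', ih.1, transduce_append, ih.2, zero_add, hb, ← ih.1,
        Function.iterate_succ_apply']
    · rw [ih.1, List.map_append, List.sum_append, ih.2, hb]

theorem block_ne_nil (a : X) (r : List X) (n : ℕ) : (block g k δ a r n).2 ≠ [] := by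
  induction n with
  | zero => simp [block]
  | succ n ih =>
    rw [block, Function.iterate_succ_apply']
    change transduce g k δ (block g k δ a r n).1 (block g k δ a r n).2 ≠ []
    obtain ⟨x, l, h⟩ := List.exists_cons_of_ne_nil ih
    simp [h, transduce]

end Coding

/-- A system whose iterates extend each other strictly generates an infinite word all of whose
prefixes are prefixes of iterates. -/
theorem exists_generates {Γ : Type*} (S : PD0LSystem Γ) (h : ∀ n, S.iter n <+: S.iter (n + 1))
    (hl : ∀ n, n < (S.iter n).length) : ∃ u, S.Generates u := by
  have hmono : ∀ {m n}, m ≤ n → S.iter m <+: S.iter n := fun {m n} hmn => by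
    induction hmn with
    | refl => exact List.prefix_rfl
    | step _ ih => exact ih.trans (h _)
  -- `S.iter n` already has a letter at position `n`, and later iterates only extend it.
  refine ⟨fun n => (S.iter n)[n]'(hl n), fun N => Filter.eventually_atTop.2 ⟨N, fun n hn => ?_⟩⟩
  rw [List.prefix_iff_eq_take]
  refine List.ext_getElem ?_ fun i h₁ h₂ => ?_
  · simpa using hn.trans (hl n).le
  · simp only [List.length_map, List.length_range] at h₁
    simp only [List.getElem_map, List.getElem_range, List.getElem_take]
    exact (hmono (h₁.le.trans hn)).getElem _

end PD0LSystem

/-! ### Counter machines -/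

/-- Operations on a counter, regarded as a stack of digits in base `b`. -/
inductive CounterOp
  | keep
  | pop
  | push (c : ℕ)

/-- The effect of an operation on a counter. -/
def CounterOp.apply (b : ℕ) : CounterOp → ℕ → ℕ
  | keep, n => n
  | pop, n => n / b
  | push c, n => b * n + c

/-- The number of units which an operation adds to a counter regardless of its value. -/
def CounterOp.extra : CounterOp → ℕ
  | push c => c
  | _ => 0

/-- A machine with counters indexed by `K`, states `Q` and output letters `O`. In each step it
operates on the counter selected by its state, and the last digit in base `b` of this counter
decides about the next state. -/
structure CounterMachine (K O Q : Type) where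
  /-- the selected counter -/
  idx : Q → K
  /-- the operation on the selected counter -/
  op : Q → CounterOp
  /-- the next state, given the last digit of the selected counter -/
  next : Q → ℕ → Q
  /-- the output -/
  out : Q → Option O

namespace CounterMachine

variable {K O Q : Type} [DecidableEq K] (M : CounterMachine K O Q) (b : ℕ)

/-- One step of the machine. -/
def step (c : Q × (K → ℕ)) : Q × (K → ℕ) :=
  (M.next c.1 (c.2 (M.idx c.1) % b),
    Function.update c.2 (M.idx c.1) ((M.op c.1).apply b (c.2 (M.idx c.1))))

/-- The output of the first `t` steps. -/
def output (c : Q × (K → ℕ)) (t : ℕ) : List O :=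
  (List.range t).flatMap fun i => (M.out ((M.step b)^[i] c).1).toList

end CounterMachine

/-! ### Simulation of a counter machine by a transduction -/

/-- The letters of the simulation of a counter machine: a starting letter, a padding letter, output
letters, units of the counters, activated units, and control letters of given phase and width. -/
inductive SimLetter (K O G : Type)
  | start
  | pad
  | out (o : O)
  | unit (i : K)
  | act (i : K)
  | ctl (φ : Fin 3) (g : G)
  deriving DecidableEq

namespace SimLetter

variable {K O Q : Type} {S b : ℕ}

instance {G : Type} [Finite K] [Finite O] [Finite G] : Finite (SimLetter K O G) := by
  let f : SimLetter K O G → Unit ⊕ Unit ⊕ O ⊕ K ⊕ K ⊕ (Fin 3 × G)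
    | start => .inl ()
    | pad => .inr (.inl ())
    | out o => .inr (.inr (.inl o))
    | unit i => .inr (.inr (.inr (.inl i)))
    | act i => .inr (.inr (.inr (.inr (.inl i))))
    | ctl φ g => .inr (.inr (.inr (.inr (.inr (φ, g)))))
  refine Finite.of_injective f fun x y h => ?_
  cases x <;> cases y <;> simp_all [f]

/-- The width of a letter. -/
def wt : SimLetter K O (ZMod S × ZMod b) → ZMod S × ZMod b
  | act _ => (0, 1)
  | ctl _ g => g
  | _ => 0

/-- The output carried by a letter. -/
def out? {G : Type} : SimLetter K O G → Option O
  | out o => some o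
  | _ => none

variable [DecidableEq K] (M : CounterMachine K O Q) (enc : Q → ZMod S) (dec : ZMod S → Option Q)
  (q₀ : Q)

/-- The transduction which simulates a counter machine. The first component of the state encodes
the state of the machine, and is `0` in idle phases; the second one counts activated units. -/
def trans (s : ZMod S × ZMod b) :
    SimLetter K O (ZMod S × ZMod b) → List (SimLetter K O (ZMod S × ZMod b))
  | start => [start, ctl 2 (enc q₀, 0)]
  | pad => []
  | out _ => []
  | unit i =>
    match dec s.1 with
    | some q => if i = M.idx q then [act i] else [unit i]
    | none => [unit i]
  | act i =>
    match dec s.1 with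
    | some q =>
      match M.op q with
      | .keep => [unit i]
      | .pop => if s.2 + 1 = 0 then [unit i] else []
      | .push _ => List.replicate b (unit i)
    | none => []
  | ctl 0 _ => [ctl 1 (-s.1, 0)]
  | ctl 1 _ =>
    match dec s.1 with
    | some q => List.replicate (M.op q).extra (unit (M.idx q)) ++ (M.out q).toList.map out ++
        [ctl 2 (enc (M.next q s.2.val), -s.2)]
    | none => []
  | ctl 2 _ => [ctl 0 0]

variable {M enc dec q₀} (k : SimLetter K O (ZMod S × ZMod b) → ℕ)

local notation "tr" => PD0LSystem.transduce pad k (trans M enc dec q₀)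

theorem transduce_pads (s : ZMod S × ZMod b) (m : ℕ) :
    ∃ m', tr s (List.replicate m pad) = List.replicate m' pad := by
  induction m generalizing s with
  | zero => exact ⟨0, rfl⟩
  | succ m ih =>
    obtain ⟨m', h⟩ := ih (s + PD0LSystem.width k pad)
    exact ⟨k pad + 1 + m', by
      rw [List.replicate_succ, PD0LSystem.transduce, h, List.replicate_add (k pad + 1)]; rfl⟩

variable {k} (hk : ∀ x, PD0LSystem.width k x = wt x)
include hk

omit [DecidableEq K] in
theorem sum_width_eq_zero {y : List (SimLetter K O (ZMod S × ZMod b))} (hy : ∀ x ∈ y, wt x = 0) :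
    (y.map (PD0LSystem.width k)).sum = (0 : ZMod S × ZMod b) := by
  induction y with
  | nil => rfl
  | cons x y ih =>
    simp only [List.map_cons, List.sum_cons, hk, hy x (by simp)]
    rw [ih fun x hx => hy x (by simp [hx]), add_zero]

theorem sum_width_act {i₀ : K} {y : List (SimLetter K O (ZMod S × ZMod b))} [DecidableEq O]
    (hy : ∀ x ∈ y, x = act i₀ ∨ wt x = 0 ∧ x ≠ act i₀) :
    (y.map (PD0LSystem.width k)).sum = ((0, (y.count (act i₀) : ZMod b)) : ZMod S × ZMod b) := by
  induction y with
  | nil => simp; rfl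
  | cons x y ih =>
    have h := ih fun x hx => hy x (by simp [hx])
    simp only [List.map_cons, List.sum_cons, hk, h]
    rcases hy x (by simp) with rfl | ⟨h, h'⟩
    · simp [wt, add_comm]
    · rw [h, List.count_cons_of_ne h', zero_add]

variable [DecidableEq O]

/-- Widths belong to letters, so a counter can be counted only after its units have been renamed:
`act` has width `(0, 1)`, whereas units of the other counters keep width `0`. -/
theorem transduce_activate {q : Q} {s : ZMod S × ZMod b} (hq : dec s.1 = some q)
    {y : List (SimLetter K O (ZMod S × ZMod b))}
    (hy : ∀ x ∈ y, x = pad ∨ (∃ o, x = out o) ∨ ∃ i, x = unit i) :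
    (∀ x ∈ tr s y, x = pad ∨ x = act (M.idx q) ∨ ∃ i ≠ M.idx q, x = unit i) ∧
      (∀ i ≠ M.idx q, (tr s y).count (unit i) = y.count (unit i)) ∧
      (tr s y).count (act (M.idx q)) = y.count (unit (M.idx q)) := by
  induction y with
  | nil => simp [PD0LSystem.transduce]
  | cons x y ih =>
    have hw : s + PD0LSystem.width k x = s := by
      rw [hk]
      rcases hy x (by simp) with rfl | ⟨o, rfl⟩ | ⟨i, rfl⟩ <;> simp [wt]
    obtain ⟨h1, h2, h3⟩ := ih fun x hx => hy x (by simp [hx])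
    rw [PD0LSystem.transduce, hw]
    rcases hy x (by simp) with rfl | ⟨o, rfl⟩ | ⟨i, rfl⟩
    · simp +contextual [trans, List.count_append, List.count_replicate, h2, h3, or_imp]
      exact h1
    · simp +contextual [trans, List.count_append, List.count_replicate, h2, h3, or_imp]
      exact h1
    · by_cases hi : i = M.idx q
      · subst hi
        simp +contextual [trans, hq, List.count_append, List.count_replicate, h2, h3, or_imp,
          Ne.symm]
        exact h1
      · simp +contextual [trans, hq, hi, List.count_append, List.count_replicate, h2, h3, or_imp,
          List.count_cons]
        exact h1

/-- The idle pass preserves the counters while the control letter at the end of the block restores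
the state of the transducer. Output letters disappear, so none is repeated. -/
theorem transduce_idle {s : ZMod S × ZMod b} (hq : dec s.1 = none)
    {y : List (SimLetter K O (ZMod S × ZMod b))}
    (hy : ∀ x ∈ y, x = pad ∨ (∃ o, x = out o) ∨ ∃ i, x = unit i) :
    (∀ x ∈ tr s y, x = pad ∨ ∃ i, x = unit i) ∧
      ∀ i, (tr s y).count (unit i) = y.count (unit i) := by
  induction y with
  | nil => simp [PD0LSystem.transduce]
  | cons x y ih =>
    have hw : s + PD0LSystem.width k x = s := by
      rw [hk]
      rcases hy x (by simp) with rfl | ⟨o, rfl⟩ | ⟨i, rfl⟩ <;> simp [wt]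
    obtain ⟨h1, h2⟩ := ih fun x hx => hy x (by simp [hx])
    rw [PD0LSystem.transduce, hw]
    rcases hy x (by simp) with rfl | ⟨o, rfl⟩ | ⟨i, rfl⟩
    · simp +contextual [trans, List.count_append, List.count_replicate, h2, or_imp]
      exact h1
    · simp +contextual [trans, List.count_append, List.count_replicate, h2, or_imp]
      exact h1
    · simp +contextual [trans, hq, List.count_append, List.count_replicate, h2, or_imp,
          List.count_cons]
      exact h1

/-- Division by `b` keeps one unit at each multiple of `b` of the running count. With `j` activated
units already read, `j / b` have been kept, which explains the correction terms. The `extra` units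
are added separately because `ctl 1` produces them at the end of the block. -/
theorem transduce_execute [NeZero b] {q : Q} {s : ZMod S} (hq : dec s = some q) (j : ℕ)
    {y : List (SimLetter K O (ZMod S × ZMod b))}
    (hy : ∀ x ∈ y, x = pad ∨ x = act (M.idx q) ∨ ∃ i ≠ M.idx q, x = unit i) :
    (∀ x ∈ tr (s, (j : ZMod b)) y, x = pad ∨ ∃ i, x = unit i) ∧
      (∀ i ≠ M.idx q, (tr (s, (j : ZMod b)) y).count (unit i) = y.count (unit i)) ∧
      (tr (s, (j : ZMod b)) y).count (unit (M.idx q)) + (M.op q).extra +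
        (match M.op q with | .pop => j / b | _ => 0) =
          (M.op q).apply b (y.count (act (M.idx q)) + (match M.op q with | .pop => j | _ => 0)) := by
  induction y generalizing j with
  | nil => cases M.op q <;> simp [PD0LSystem.transduce, CounterOp.apply, CounterOp.extra]
  | cons x y ih =>
    have hy' := fun x hx => hy x (List.mem_cons_of_mem _ hx)
    rw [PD0LSystem.transduce, hk]
    rcases hy x (by simp) with rfl | rfl | ⟨i, hi, rfl⟩
    · obtain ⟨h1, h2, h3⟩ := ih j hy'
      simp only [wt, add_zero]
      simp +contextual [trans, List.count_append, List.count_replicate, h2, or_imp]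
      exact ⟨h1, h3⟩
    · obtain ⟨h1, h2, h3⟩ := ih (j + 1) hy'
      have hw : ((s, (j : ZMod b)) : ZMod S × ZMod b) +
          wt (act (M.idx q) : SimLetter K O (ZMod S × ZMod b)) = (s, ((j + 1 : ℕ) : ZMod b)) := by
        simp [wt]
      rw [hw]
      generalize tr (s, ((j + 1 : ℕ) : ZMod b)) y = z at h1 h2 h3 ⊢
      have hz : (j : ZMod b) + 1 = 0 ↔ b ∣ j + 1 := by
        rw [← ZMod.natCast_eq_zero_iff]; push_cast; rfl
      have hd := Nat.succ_div (a := j) (b := b)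
      rcases hop : M.op q with _ | _ | c
      · simp +contextual [hop, trans, hq, List.count_append, List.count_replicate, or_imp,
          CounterOp.apply, CounterOp.extra, Ne.symm] at h3 ⊢
        exact ⟨h1, h2, by omega⟩
      · simp only [hop, CounterOp.apply, CounterOp.extra] at h3
        have e : y.count (act (M.idx q)) + (j + 1) = y.count (act (M.idx q)) + 1 + j := by ring
        rw [e] at h3
        by_cases hb : b ∣ j + 1
        · simp +contextual [hop, trans, hq, List.count_append, List.count_replicate, or_imp,
            CounterOp.apply, CounterOp.extra, Ne.symm, hz, hb]
          simp only [hb, if_true] at hd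
          exact ⟨h1, h2, by rw [← h3, hd]; ring⟩
        · simp +contextual [hop, trans, hq, List.count_append, List.count_replicate, or_imp,
            CounterOp.apply, CounterOp.extra, Ne.symm, hz, hb]
          simp only [hb, if_false] at hd
          exact ⟨h1, h2, by rw [← h3, hd]; ring⟩
      · simp +contextual [hop, trans, hq, List.count_append, List.count_replicate, or_imp,
          CounterOp.apply, CounterOp.extra, Ne.symm] at h3 ⊢
        exact ⟨h1, h2, by rw [mul_add, ← h3]; ring⟩
    · obtain ⟨h1, h2, h3⟩ := ih j hy'
      simp only [wt, add_zero]
      simp +contextual [trans, hq, hi, List.count_append, List.count_replicate, h2, or_imp,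
        List.count_cons]
      exact ⟨h1, h3⟩

/-- A block represents a configuration of the machine at the beginning of a step, together
with the state of the transduction in which it is read. -/
def Represents (enc : Q → ZMod S) (c : Q × (K → ℕ))
    (B : (ZMod S × ZMod b) × List (SimLetter K O (ZMod S × ZMod b))) : Prop :=
  B.1.1 = 0 ∧ ∃ y m, B.2 = y ++ ctl 2 (enc c.1, -B.1.2) :: List.replicate m pad ∧
    (∀ x ∈ y, x = pad ∨ (∃ o, x = out o) ∨ ∃ i, x = unit i) ∧ ∀ i, y.count (unit i) = c.2 i

omit hk [DecidableEq O] [DecidableEq K] in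
theorem filterMap_out?_eq_nil {G : Type} {y : List (SimLetter K O G)}
    (hy : ∀ x ∈ y, out? x = none) : y.filterMap out? = [] := by
  simpa using hy

/-- The successor of a block. -/
def nextBlock (M : CounterMachine K O Q) (enc : Q → ZMod S) (dec : ZMod S → Option Q) (q₀ : Q)
    (k : SimLetter K O (ZMod S × ZMod b) → ℕ)
    (B : (ZMod S × ZMod b) × List (SimLetter K O (ZMod S × ZMod b))) :
    (ZMod S × ZMod b) × List (SimLetter K O (ZMod S × ZMod b)) :=
  (B.1 + (B.2.map (PD0LSystem.width k)).sum,
    PD0LSystem.transduce pad k (trans M enc dec q₀) B.1 B.2)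

omit [DecidableEq O] in
theorem nextBlock_append_ctl (s : ZMod S × ZMod b) (y : List (SimLetter K O (ZMod S × ZMod b)))
    (φ : Fin 3) (g : ZMod S × ZMod b) (m : ℕ) :
    ∃ m', nextBlock M enc dec q₀ k (s, y ++ ctl φ g :: List.replicate m pad) =
      (s + (y.map (PD0LSystem.width k)).sum + g,
        tr s y ++ trans M enc dec q₀ (s + (y.map (PD0LSystem.width k)).sum) (ctl φ g) ++
          List.replicate m' pad) := by
  obtain ⟨m', h⟩ := transduce_pads (M := M) (enc := enc) (dec := dec) (q₀ := q₀) k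
    (s + (y.map (PD0LSystem.width k)).sum + PD0LSystem.width k (ctl φ g)) m
  refine ⟨k (ctl φ g) + 1 + m', ?_⟩
  rw [nextBlock, PD0LSystem.transduce_append, PD0LSystem.transduce, h,
    List.replicate_add (k (ctl φ g) + 1)]
  simp [hk, wt, add_assoc]

/-- The first pass is idle, and the width of `ctl 2` then moves the state from `(0, r)` to `(enc
c.1, 0)`. The second pass activates the selected counter. The third executes the operation while
counting the counter modulo `b`; `ctl 1` reads this residue to choose the next state, and its width
resets the first component to `0`. -/
theorem represents_step [NeZero b] (hdec : dec 0 = none) {c : Q × (K → ℕ)}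
    (hc : dec (enc c.1) = some c.1)
    {B : (ZMod S × ZMod b) × List (SimLetter K O (ZMod S × ZMod b))} (hB : Represents enc c B) :
    Represents enc (M.step b c) ((nextBlock M enc dec q₀ k)^[3] B) ∧
      (nextBlock M enc dec q₀ k B).2.filterMap out? = [] ∧
      ((nextBlock M enc dec q₀ k)^[2] B).2.filterMap out? = [] ∧
      ((nextBlock M enc dec q₀ k)^[3] B).2.filterMap out? = (M.out c.1).toList := by
  obtain ⟨⟨s, r⟩, l⟩ := B
  obtain ⟨hs, y, m, hl, hy, hN⟩ := hB
  simp only at hs hl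
  subst hs hl
  have hw : ∀ {y : List (SimLetter K O (ZMod S × ZMod b))},
      (∀ x ∈ y, x = pad ∨ (∃ o, x = out o) ∨ ∃ i, x = unit i) → ∀ x ∈ y, wt x = 0 := by
    intro y hy x hx
    rcases hy x hx with rfl | ⟨o, rfl⟩ | ⟨i, rfl⟩ <;> rfl
  obtain ⟨m₁, h₁⟩ := nextBlock_append_ctl (M := M) (enc := enc) (dec := dec) (q₀ := q₀) hk
    (0, r) y 2 (enc c.1, -r) m
  obtain ⟨hy₁, hN₁⟩ := transduce_idle (M := M) (enc := enc) (q₀ := q₀) hk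
    (s := ((0, r) : ZMod S × ZMod b)) hdec hy
  generalize tr (0, r) y = y₁ at h₁ hy₁ hN₁
  rw [sum_width_eq_zero hk (hw hy)] at h₁
  have hy₁' : ∀ x ∈ y₁, x = pad ∨ (∃ o, x = out o) ∨ ∃ i, x = unit i :=
    fun x hx => (hy₁ x hx).imp_right Or.inr
  have e₁ : ((0, r) : ZMod S × ZMod b) + 0 + (enc c.1, -r) = (enc c.1, 0) := by simp
  simp only [e₁, trans, List.append_assoc, List.singleton_append] at h₁
  obtain ⟨m₂, h₂⟩ := nextBlock_append_ctl (M := M) (enc := enc) (dec := dec) (q₀ := q₀) hk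
    (enc c.1, 0) y₁ 0 0 m₁
  obtain ⟨hy₂, hN₂, hA₂⟩ := transduce_activate (M := M) (enc := enc) (q₀ := q₀) hk
    (s := ((enc c.1, 0) : ZMod S × ZMod b)) hc hy₁'
  generalize tr (enc c.1, 0) y₁ = y₂ at h₂ hy₂ hN₂ hA₂
  rw [sum_width_eq_zero hk (hw hy₁')] at h₂
  simp only [add_zero, trans, List.append_assoc, List.singleton_append] at h₂
  obtain ⟨m₃, h₃⟩ := nextBlock_append_ctl (M := M) (enc := enc) (dec := dec) (q₀ := q₀) hk
    (enc c.1, 0) y₂ 1 (-enc c.1, 0) m₂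
  obtain ⟨hy₃, hN₃, hA₃⟩ := transduce_execute (M := M) (enc := enc) (q₀ := q₀) hk hc 0 hy₂
  rw [Nat.cast_zero] at hy₃ hN₃ hA₃
  generalize tr (enc c.1, 0) y₂ = y₃ at h₃ hy₃ hN₃ hA₃
  have hy₂' : ∀ x ∈ y₂, x = act (M.idx c.1) ∨ wt x = 0 ∧ x ≠ act (M.idx c.1) := by
    intro x hx
    rcases hy₂ x hx with rfl | rfl | ⟨i, -, rfl⟩ <;> simp [wt]
  rw [sum_width_act hk hy₂', hA₂, hN₁, hN] at h₃
  have hval : ((c.2 (M.idx c.1) : ℕ) : ZMod b).val = c.2 (M.idx c.1) % b := ZMod.val_natCast _ _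
  simp only [trans, Prod.mk_add_mk, add_zero, zero_add, hc, add_neg_cancel, hval] at h₃
  have hA : y₃.count (unit (M.idx c.1)) + (M.op c.1).extra =
      (M.op c.1).apply b (c.2 (M.idx c.1)) := by
    rw [hA₂, hN₁, hN] at hA₃
    cases hop : M.op c.1 <;> simp only [hop] at hA₃ ⊢ <;> simpa using hA₃
  simp only [Function.iterate_succ, Function.iterate_zero, Function.comp_apply, id, h₁, h₂, h₃]
  refine ⟨⟨rfl, y₃ ++ List.replicate (M.op c.1).extra (unit (M.idx c.1)) ++
      (M.out c.1).toList.map out, m₃, ?_, ?_, ?_⟩, ?_, ?_, ?_⟩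
  · simp [CounterMachine.step]
  · intro x hx
    simp only [List.mem_append, List.mem_map, List.mem_replicate] at hx
    rcases hx with (hx | ⟨-, rfl⟩) | ⟨o, -, rfl⟩
    · exact (hy₃ x hx).imp_right Or.inr
    · exact .inr (.inr ⟨_, rfl⟩)
    · exact .inr (.inl ⟨_, rfl⟩)
  · intro i
    have ho : ((M.out c.1).toList.map (out (K := K) (G := ZMod S × ZMod b))).count (unit i) = 0 :=
      List.count_eq_zero.2 (by simp)
    rw [List.count_append, List.count_append, ho, add_zero, CounterMachine.step,
      List.count_replicate]
    by_cases hi : i = M.idx c.1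
    · subst hi
      simpa using hA
    · rw [hN₃ i hi, hN₂ i hi, hN₁, hN]
      simp [hi, Ne.symm hi]
  · rw [List.filterMap_append, filterMap_out?_eq_nil (y := y₁)]
    · simp [out?]
    · intro x hx
      rcases hy₁ x hx with rfl | ⟨i, rfl⟩ <;> rfl
  · rw [List.filterMap_append, filterMap_out?_eq_nil (y := y₂)]
    · simp [out?]
    · intro x hx
      rcases hy₂ x hx with rfl | rfl | ⟨i, -, rfl⟩ <;> rfl
  · simp only [List.filterMap_append]
    rw [filterMap_out?_eq_nil (y := y₃)]
    · have h1 : (List.replicate (M.op c.1).extra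
          (unit (G := ZMod S × ZMod b) (O := O) (M.idx c.1))).filterMap out? = [] :=
        filterMap_out?_eq_nil fun x hx => by rw [List.eq_of_mem_replicate hx]; rfl
      have h2 : (List.replicate m₃ (pad : SimLetter K O (ZMod S × ZMod b))).filterMap out? = [] :=
        filterMap_out?_eq_nil fun x hx => by rw [List.eq_of_mem_replicate hx]; rfl
      rw [h1, h2]
      cases M.out c.1 <;> rfl
    · intro x hx
      rcases hy₃ x hx with rfl | ⟨i, rfl⟩ <;> rfl

end SimLetter

/-! ### Sparse embedding from erased prefixes -/

theorem sparselyEmbedded_of_filterMap {O Γ : Type*} (ι : O ↪ Γ) (π : Γ → Option O)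
    (hπ : ∀ x o, π x = some o ↔ x = ι o) (w : ℕ → O) (u : ℕ → Γ)
    (h : ∀ N i a, (((List.range N).map u).filterMap π)[i]? = some a → a = w i)
    (hl : ∀ n, ∃ N, n ≤ (((List.range N).map u).filterMap π).length) :
    SparselyEmbedded ι w u := by
  classical
  set P : ℕ → Prop := fun n => u n ∈ Set.range ι with hP
  have hnone : ∀ n, ¬ P n → π (u n) = none := fun n hn => by
    by_contra hne
    obtain ⟨o, ho⟩ := Option.ne_none_iff_exists'.1 hne
    exact hn ⟨o, ((hπ _ _).1 ho).symm⟩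
  -- This identifies indices after erasure with the enumeration `Nat.nth P` of the retained
  -- positions.
  have hcount : ∀ N, (((List.range N).map u).filterMap π).length = Nat.count P N := by
    intro N
    induction N with
    | zero => simp
    | succ N ih =>
      rw [List.range_succ, List.map_append, List.filterMap_append, List.length_append, ih,
        Nat.count_succ]
      by_cases hN : P N
      · obtain ⟨o, ho⟩ := hN
        have := (hπ _ _).2 ho.symm
        simp [this, show P N from ⟨o, ho⟩]
      · simp [hnone N hN, hN]
  have hinf : {n | P n}.Infinite := by
    intro hfin
    obtain ⟨N, hN⟩ := hl (hfin.toFinset.card + 1)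
    have := Nat.count_le_card hfin N
    rw [hcount] at hN
    exact Nat.lt_irrefl _ (hN.trans this)
  refine ⟨Nat.nth P, Nat.nth_strictMono hinf, Nat.range_nth_of_infinite hinf, fun n => ?_⟩
  obtain ⟨o, ho⟩ : P (Nat.nth P n) := Nat.nth_mem_of_infinite hinf n
  have ho' := (hπ _ _).2 ho.symm
  rw [← ho]
  congr 1
  refine h (Nat.nth P n + 1) n o ?_
  have hlen : (((List.range (Nat.nth P n)).map u).filterMap π).length = n := by
    rw [hcount, Nat.count_nth_of_infinite hinf]
  rw [List.range_succ, List.map_append, List.filterMap_append, List.getElem?_append_right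
    (by rw [hlen]), hlen]
  simp [ho']

/-! ### Output of the simulation -/

namespace SimLetter

variable {K O Q : Type} {S b : ℕ} [DecidableEq K] [DecidableEq O]
  {M : CounterMachine K O Q} {enc : Q → ZMod S} {dec : ZMod S → Option Q} {q₀ : Q}
  {k : SimLetter K O (ZMod S × ZMod b) → ℕ}

omit [DecidableEq O] in
theorem block_eq (n : ℕ) :
    PD0LSystem.block pad k (trans M enc dec q₀) start [ctl 2 (enc q₀, 0)] n =
      (nextBlock M enc dec q₀ k)^[n] (PD0LSystem.width k start,
        [ctl 2 (enc q₀, 0)] ++ List.replicate (k start + 1) pad) := rfl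

theorem represents_block [NeZero b] (hk : ∀ x, PD0LSystem.width k x = wt x) (hdec : dec 0 = none)
    (hmem : ∀ t, dec (enc ((M.step b)^[t] (q₀, 0)).1) = some ((M.step b)^[t] (q₀, 0)).1) (t : ℕ) :
    Represents enc ((M.step b)^[t] (q₀, 0))
      (PD0LSystem.block pad k (trans M enc dec q₀) start [ctl 2 (enc q₀, 0)] (3 * t)) := by
  induction t with
  | zero =>
    simp only [Nat.mul_zero, block_eq, Function.iterate_zero, id, hk]
    exact ⟨rfl, [], k start + 1, by simp [wt], by simp, by simp⟩
  | succ t ih =>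
    rw [block_eq] at ih ⊢
    rw [Function.iterate_succ_apply', show 3 * (t + 1) = 3 + 3 * t by ring,
      Function.iterate_add_apply]
    exact (represents_step hk hdec (hmem t) ih).1

theorem filterMap_iterate_transduce [NeZero b] (hk : ∀ x, PD0LSystem.width k x = wt x)
    (hdec : dec 0 = none)
    (hmem : ∀ t, dec (enc ((M.step b)^[t] (q₀, 0)).1) = some ((M.step b)^[t] (q₀, 0)).1) (t : ℕ) :
    ((PD0LSystem.transduce pad k (trans M enc dec q₀) 0)^[3 * t + 1] [start]).filterMap out? =
      M.output b (q₀, 0) t := by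
  have hL := fun n => (PD0LSystem.transduce_iterate (g := pad) (k := k)
    (δ := trans M enc dec q₀) start [ctl 2 (enc q₀, 0)] (fun _ => rfl) n).1
  induction t with
  | zero =>
    rw [hL]
    simp [block_eq, CounterMachine.output, out?]
  | succ t ih =>
    have hr := represents_block hk hdec hmem t
    obtain ⟨-, h1, h2, h3⟩ := represents_step (q₀ := q₀) hk hdec (hmem t) hr
    rw [block_eq, ← Function.iterate_succ_apply' (nextBlock M enc dec q₀ k)] at h1
    rw [block_eq, ← Function.iterate_add_apply (nextBlock M enc dec q₀ k)] at h2 h3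
    -- One machine step appends three blocks, of which only the last can carry an output letter.
    rw [show 3 * (t + 1) + 1 = 3 * t + 1 + 1 + 1 + 1 by ring, hL, hL, hL]
    simp only [List.filterMap_append, ih, block_eq]
    rw [h1, show 3 * t + 1 + 1 = 2 + 3 * t by ring, h2,
      show 3 * t + 3 = 3 + 3 * t by ring, h3]
    simp [CounterMachine.output, List.range_succ]

omit [DecidableEq K] [DecidableEq O] in
theorem filterMap_flatMap_code {G : Type} (k : SimLetter K O G → ℕ) (l : List (SimLetter K O G)) :
    (l.flatMap (PD0LSystem.code pad k)).filterMap out? = l.filterMap out? := by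
  induction l with
  | nil => rfl
  | cons x l ih =>
    rw [List.flatMap_cons, List.filterMap_append, ih, PD0LSystem.code, List.filterMap_cons,
      List.filterMap_cons, filterMap_out?_eq_nil (y := List.replicate (k x) pad)
        (fun y hy => by rw [List.eq_of_mem_replicate hy]; rfl)]
    cases out? x <;> rfl

end SimLetter

/-! ### Choice of paddings and state codes, and the resulting PD0L system -/

/-- By the Chinese remainder theorem, every prescribed width is realized by some amount of padding.
-/
theorem exists_natCast_succ_eq {S b : ℕ} [NeZero S] [NeZero b] (h : S.Coprime b)
    (g : ZMod S × ZMod b) : ∃ k : ℕ, ((k + 1 : ℕ) : ZMod S × ZMod b) = g := by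
  obtain ⟨k, h1, h2⟩ := Nat.chineseRemainder h (g.1 - 1).val (g.2 - 1).val
  refine ⟨k, ?_⟩
  rw [← ZMod.natCast_eq_natCast_iff, ZMod.natCast_zmod_val] at h1 h2
  ext <;> simp [h1, h2]

theorem Set.Finite.exists_encoding {Q : Type} {F : Set Q} (hF : F.Finite) {b : ℕ} (hb : b ≠ 0) :
    ∃ (S : ℕ) (enc : Q → ZMod S) (dec : ZMod S → Option Q), S ≠ 0 ∧ S.Coprime b ∧ dec 0 = none ∧
      ∀ q ∈ F, dec (enc q) = some q := by
  classical
  obtain ⟨f, hf⟩ := Set.countable_iff_exists_injOn.1 hF.countable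
  obtain ⟨B, hB⟩ := (hF.image f).bddAbove
  have hB' : ∀ q ∈ F, f q ≤ B := fun q hq => hB ⟨q, hq, rfl⟩
  have hb := Nat.pos_of_ne_zero hb
  -- The modulus `b * (B + 1) + 1` is coprime to `b` and exceeds every code `f q + 1`; the shift by
  -- one reserves `0` for idle passes.
  have hS : B + 1 < b * (B + 1) + 1 := by nlinarith
  have hinj : ∀ m n : ℕ, m ≤ B + 1 → n ≤ B + 1 →
      ((m : ZMod (b * (B + 1) + 1)) = n) → m = n := fun m n hm hn h => by
    rw [ZMod.natCast_eq_natCast_iff] at h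
    exact Nat.ModEq.eq_of_lt_of_lt h (by omega) (by omega)
  refine ⟨b * (B + 1) + 1, fun q => ((f q + 1 : ℕ) : ZMod (b * (B + 1) + 1)),
    fun z => if h : ∃ q ∈ F, ((f q + 1 : ℕ) : ZMod (b * (B + 1) + 1)) = z
      then some h.choose else none, by omega, by simp, ?_, ?_⟩
  · refine dif_neg ?_
    rintro ⟨q, hq, h⟩
    have := hinj (f q + 1) 0 (by have := hB' q hq; omega) (by omega) (by rw [h]; simp)
    omega
  · intro q hq
    have h : ∃ q' ∈ F, ((f q' + 1 : ℕ) : ZMod (b * (B + 1) + 1)) = ((f q + 1 : ℕ) : ZMod _) :=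
      ⟨q, hq, rfl⟩
    refine (dif_pos h).trans ?_
    have h1 := hB' _ h.choose_spec.1
    have h2 := hB' q hq
    have := hinj _ _ (by omega) (by omega) h.choose_spec.2
    exact congrArg some (hf h.choose_spec.1 hq (by omega))

/-- The output of a counter machine which visits only finitely many states is sparsely embedded in
a word generated by a non-erasing system. -/
theorem CounterMachine.exists_pd0l {K O Q : Type} [Finite K] [Finite O] [DecidableEq K]
    (M : CounterMachine K O Q) (b : ℕ) [NeZero b] (q₀ : Q) {F : Set Q} (hF : F.Finite)
    (hmem : ∀ t, ((M.step b)^[t] (q₀, 0)).1 ∈ F) (w : ℕ → O)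
    (hw : ∀ t i a, (M.output b (q₀, 0) t)[i]? = some a → a = w i)
    (hl : ∀ n, ∃ t, n ≤ (M.output b (q₀, 0) t).length) :
    ∃ (Γ : Type) (_ : Finite Γ) (ι : O ↪ Γ) (S : PD0LSystem Γ) (u : ℕ → Γ),
      ¬ Function.Surjective ι ∧ S.NonErasing ∧ S.Generates u ∧ SparselyEmbedded ι w u := by
  classical
  obtain ⟨S, enc, dec, hS, hSb, hdec, hF'⟩ := hF.exists_encoding (NeZero.ne b)
  have : NeZero S := ⟨hS⟩
  have hp : ((S * b : ℕ) : ZMod S × ZMod b) = 0 := by ext <;> simp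
  choose k hk using fun x : SimLetter K O (ZMod S × ZMod b) =>
    exists_natCast_succ_eq hSb (SimLetter.wt x)
  have hk' : ∀ x, PD0LSystem.width k x = SimLetter.wt x := hk
  have hmem' := fun t => hF' _ (hmem t)
  set T := PD0LSystem.coded (k := k) (δ := SimLetter.trans M enc dec q₀) (S * b) hp
    (g := SimLetter.pad) (fun _ => rfl) SimLetter.start [SimLetter.ctl 2 (enc q₀, 0)]
    (fun _ => rfl) with hT
  have hit := PD0LSystem.coded_iter (k := k) (δ := SimLetter.trans M enc dec q₀) (p := S * b) hp
    (g := SimLetter.pad) (fun _ => rfl) SimLetter.start [SimLetter.ctl 2 (enc q₀, 0)]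
    (fun _ => rfl)
  rw [← hT] at hit
  have hL := fun n => (PD0LSystem.transduce_iterate (g := SimLetter.pad) (k := k)
    (δ := SimLetter.trans M enc dec q₀) SimLetter.start [SimLetter.ctl 2 (enc q₀, 0)]
    (fun _ => rfl) n).1
  have hstep : ∀ n, ∃ y, y ≠ [] ∧ T.iter (n + 1) = T.iter n ++ y := fun n => by
    refine ⟨_, ?_, by rw [hit, hit, hL, List.flatMap_append]⟩
    obtain ⟨x, l, h⟩ := List.exists_cons_of_ne_nil (PD0LSystem.block_ne_nil
      (g := SimLetter.pad) (k := k) (δ := SimLetter.trans M enc dec q₀) SimLetter.start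
      [SimLetter.ctl 2 (enc q₀, 0)] n)
    simp [h, PD0LSystem.code]
  have hpre : ∀ n, T.iter n <+: T.iter (n + 1) := fun n => by
    obtain ⟨y, -, h⟩ := hstep n
    exact ⟨y, h.symm⟩
  have hlen : ∀ n, n < (T.iter n).length := by
    intro n
    induction n with
    | zero => rw [hit]; simp [PD0LSystem.code]
    | succ n ih =>
      obtain ⟨y, hy, h⟩ := hstep n
      have := List.length_pos_iff.2 hy
      rw [h, List.length_append]
      omega
  obtain ⟨u, hu⟩ := T.exists_generates hpre hlen
  have hout : ∀ t, (T.iter (3 * t + 1)).filterMap SimLetter.out? = M.output b (q₀, 0) t :=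
    fun t => by
      rw [hit, SimLetter.filterMap_flatMap_code,
        SimLetter.filterMap_iterate_transduce hk' hdec hmem']
  refine ⟨_, inferInstance, ⟨SimLetter.out, fun _ _ h => by simpa using h⟩, T, u, ?_,
    PD0LSystem.coded_nonErasing _ _ _ _ _, hu,
    sparselyEmbedded_of_filterMap _ SimLetter.out? ?_ w u ?_ ?_⟩
  · intro h
    obtain ⟨o, ho⟩ := h SimLetter.start
    simp at ho
  · intro x o
    change SimLetter.out? x = some o ↔ x = SimLetter.out o
    cases x <;> simp [SimLetter.out?]
  · intro N i a h
    obtain ⟨n, hn⟩ := Filter.eventually_atTop.1 (hu N)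
    -- An index of the form `3 * n + 1` is late enough and is one at which `hout` identifies the
    -- output.
    obtain ⟨y, hy⟩ := hn (3 * n + 1) (by omega)
    refine hw n i a ?_
    rw [← hout, ← hy, List.filterMap_append, List.getElem?_append_left, h]
    exact (List.getElem?_eq_some_iff.1 h).1
  · intro n
    obtain ⟨t, ht⟩ := hl n
    refine ⟨(T.iter (3 * t + 1)).length, ?_⟩
    obtain ⟨m, hm⟩ := Filter.eventually_atTop.1 (hu (T.iter (3 * t + 1)).length)
    have h1 := hm (max m (3 * t + 1)) (le_max_left _ _)
    have h2 : T.iter (3 * t + 1) <+: T.iter (max m (3 * t + 1)) :=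
      Nat.le_induction List.prefix_rfl (fun n _ ih => ih.trans (hpre n)) _ (le_max_right _ _)
    -- The iterate and the prefix of `u` of the same length are both prefixes of one later iterate,
    -- so they coincide.
    have h3 := (List.prefix_of_prefix_length_le h2 h1 (by simp)).eq_of_length (by simp)
    rw [← h3, hout]
    exact ht

/-! ### Runs of counter machines -/

namespace CounterMachine

variable {K O Q : Type} [DecidableEq K] (M : CounterMachine K O Q) (b : ℕ)

theorem output_add (c : Q × (K → ℕ)) (s t : ℕ) :
    M.output b c (s + t) = M.output b c s ++ M.output b ((M.step b)^[s] c) t := by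
  simp only [output, List.range_add, List.flatMap_append, List.flatMap_map,
    ← Function.iterate_add_apply]
  simp only [add_comm s]

theorem length_output_le (c : Q × (K → ℕ)) (t : ℕ) : (M.output b c t).length ≤ t := by
  induction t with
  | zero => simp [output]
  | succ t ih =>
    rw [output_add, List.length_append]
    refine add_le_add ih ?_
    simp only [output, List.range_one, List.flatMap_cons, List.flatMap_nil, List.append_nil]
    cases M.out _ <;> simp

/-- The machine passes from one configuration to another one with output `l`, and all states on
the way are in `F`. -/
def Passes (F : Set Q) (c : Q × (K → ℕ)) (l : List O) (c' : Q × (K → ℕ)) : Prop :=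
  ∃ t, (M.step b)^[t] c = c' ∧ M.output b c t = l ∧ ∀ i < t, ((M.step b)^[i] c).1 ∈ F

variable {M b} {F : Set Q}

theorem Passes.refl (c : Q × (K → ℕ)) : M.Passes b F c [] c := ⟨0, rfl, rfl, by simp⟩

theorem Passes.trans {c₁ c₂ c₃ : Q × (K → ℕ)} {l l' : List O} (h : M.Passes b F c₁ l c₂)
    (h' : M.Passes b F c₂ l' c₃) : M.Passes b F c₁ (l ++ l') c₃ := by
  obtain ⟨s, rfl, rfl, hs⟩ := h
  obtain ⟨t, rfl, rfl, ht⟩ := h'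
  refine ⟨s + t, by rw [add_comm, Function.iterate_add_apply], output_add _ _ _ _ _,
    fun i hi => ?_⟩
  rcases lt_or_ge i s with h | h
  · exact hs i h
  · obtain ⟨j, rfl⟩ := Nat.exists_eq_add_of_le h
    rw [add_comm, Function.iterate_add_apply]
    exact ht j (by omega)

theorem Passes.head {c c' : Q × (K → ℕ)} {l : List O} (hc : c.1 ∈ F)
    (h : M.Passes b F (M.step b c) l c') : M.Passes b F c ((M.out c.1).toList ++ l) c' :=
  Passes.trans ⟨1, rfl, by simp [output], by simpa using hc⟩ h

end CounterMachine

/-! ### A looping stack machine as a counter machine in base 5 -/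

namespace Turing.PartrecToTM2

open TM2

instance : Finite K' :=
  Finite.of_injective (β := Fin 4)
    (fun | .main => 0 | .rev => 1 | .aux => 2 | .stack => 3) fun x y h => by
      cases x <;> cases y <;> simp_all

/-- Statements of the stack machine. -/
abbrev Statement := TM2.Stmt (fun _ : K' => Γ') Λ' (Option Γ')

/-- The digit in base `5` of a stack symbol. -/
def digit : Γ' → ℕ
  | .consₗ => 1
  | .cons => 2
  | .bit0 => 3
  | .bit1 => 4

/-- The stack symbol with a given digit. -/
def ofDigit : ℕ → Option Γ'
  | 1 => some .consₗ
  | 2 => some .cons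
  | 3 => some .bit0
  | 4 => some .bit1
  | _ => none

/-- The number which encodes a stack. -/
def stackNum : List Γ' → ℕ
  | [] => 0
  | x :: l => 5 * stackNum l + digit x

/-- Symbols have digits `1` to `4`, so a last digit `0` signals an empty stack. -/
theorem ofDigit_stackNum_mod (l : List Γ') : ofDigit (stackNum l % 5) = l.head? := by
  cases l with
  | nil => rfl
  | cons x l => cases x <;> simp [stackNum, digit, ofDigit, Nat.add_mod]

theorem stackNum_div (l : List Γ') : stackNum l / 5 = stackNum l.tail := by
  cases l with
  | nil => rfl
  | cons x l => cases x <;> simp [stackNum, digit] <;> omega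

/-- The number with given binary digits. -/
def ofBits : List Γ' → ℕ
  | [] => 0
  | .bit0 :: l => 2 * ofBits l
  | .bit1 :: l => 2 * ofBits l + 1
  | _ :: l => ofBits l

theorem ofBits_trNat (n : ℕ) : ofBits (trNat n) = n := by
  have h : ∀ p : PosNum, ofBits (trPosNum p) = (p : ℕ) := fun p => by
    induction p with
    | one => rfl
    | bit0 p ih => rw [trPosNum, ofBits, ih, PosNum.cast_bit0]; ring
    | bit1 p ih => rw [trPosNum, ofBits, ih, PosNum.cast_bit1]; ring
  have h' : ∀ m : Num, ofBits (trNum m) = (m : ℕ) := fun m => by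
    cases m with
    | zero => rfl
    | pos p => exact h p
  rw [trNat, h', Num.to_of_nat]

/-- The states of a machine which runs a program again and again, and outputs the first entry of
the result after each run. -/
inductive LoopState
  | boot
  | run (s : Statement) (v : Option Γ')
  | scan (l : List Γ')
  | emit (l : List Γ')

/-- The machine which runs a program on the list `[0]`, removes and outputs the first entry of the
result, runs the program on the rest of the result, and so on. -/
def loopMachine {O : Type} (dec : List Γ' → Option O) (start : Λ') :
    CounterMachine K' O LoopState where
  idx
    | .run (.push k _ _) _ => k
    | .run (.peek k _ _) _ => k
    | .run (.pop k _ _) _ => k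
    | _ => .main
  op
    | .boot => .push (digit .cons)
    | .run (.push _ f _) v => .push (digit (f v))
    | .run (.pop _ _ _) _ => .pop
    | .scan _ => .pop
    | _ => .keep
  next
    | .boot, _ => .run (tr start) none
    | .run (.push _ _ q) v, _ => .run q v
    | .run (.peek _ f q) v, r => .run q (f v (ofDigit r))
    | .run (.pop _ f q) v, r => .run q (f v (ofDigit r))
    | .run (.load f q) v, _ => .run q (f v)
    | .run (.branch f q₁ q₂) v, _ => .run (cond (f v) q₁ q₂) v
    | .run (.goto f) v, _ => .run (tr (f v)) v
    | .run .halt _, _ => .scan []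
    | .scan l, r =>
      match ofDigit r with
      | some .cons => .emit l
      | some x => .scan (x :: l)
      | none => .emit l
    | .emit _, _ => .run (tr start) none
  out
    | .emit l => dec l
    | _ => none

/-- The states visited by `loopMachine`. -/
inductive LoopState.IsVisited (T : Finset Λ') (L : ℕ) : LoopState → Prop
  | boot : IsVisited T L .boot
  | run {s} (v) (h : some s ∈ stmts tr T) : IsVisited T L (.run s v)
  | scan {l} (h : l.length ≤ L) : IsVisited T L (.scan l)
  | emit {l} (h : l.length ≤ L) : IsVisited T L (.emit l)

theorem LoopState.finite_isVisited (T : Finset Λ') (L : ℕ) :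
    {q | LoopState.IsVisited T L q}.Finite := by
  have h1 : {s : Statement | some s ∈ stmts tr T}.Finite :=
    (stmts tr T).finite_toSet.preimage (Option.some_injective _).injOn
  have h2 : {l : List Γ' | l.length ≤ L}.Finite := List.finite_length_le _ _
  refine (((Set.finite_singleton LoopState.boot).union
    ((h1.prod (Set.finite_univ (α := Option Γ'))).image fun x => LoopState.run x.1 x.2)).union
    ((h2.image LoopState.scan).union (h2.image LoopState.emit))).subset ?_
  rintro q (_ | ⟨v, h⟩ | h | h)
  · exact .inl (.inl rfl)
  · exact .inl (.inr ⟨(_, v), ⟨h, Set.mem_univ _⟩, rfl⟩)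
  · exact .inr (.inl ⟨_, h, rfl⟩)
  · exact .inr (.inr ⟨_, h, rfl⟩)

/-- The configuration of `loopMachine` which corresponds to one of the stack machine. -/
def toLoop (c : TM2.Cfg (fun _ : K' => Γ') Λ' (Option Γ')) : LoopState × (K' → ℕ) :=
  (match c.l with
    | some l => .run (tr l) c.var
    | none => .scan [], fun k => stackNum (c.stk k))

variable {O : Type} {dec : List Γ' → Option O} {start : Λ'} {T : Finset Λ'} {L : ℕ}

theorem update_stackNum (S : K' → List Γ') (k : K') (l : List Γ') :
    Function.update (fun k => stackNum (S k)) k (stackNum l) =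
      fun k' => stackNum (Function.update S k l k') := by
  funext k'
  by_cases h : k' = k
  · subst h; simp
  · simp [h]

theorem passes_stepAux (s : Statement) (v : Option Γ') (S : K' → List Γ')
    (hs : some s ∈ stmts tr T) :
    (loopMachine dec start).Passes 5 {q | LoopState.IsVisited T L q}
      (.run s v, fun k => stackNum (S k)) [] (toLoop (stepAux s v S)) := by
  have hsub : ∀ q ∈ stmts₁ s, some q ∈ stmts tr T := fun q hq => stmts_trans hq hs
  -- Taking one step before the induction turns the cases `goto` and `halt` into empty runs.
  refine CounterMachine.Passes.head (l := []) (.run v hs) ?_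
  induction s generalizing v S with
  | push k f q ih =>
    have hq := hsub q (by simp [stmts₁, stmts₁_self])
    have e : (loopMachine dec start).step 5 (.run (.push k f q) v, fun k => stackNum (S k)) =
        (.run q v, fun k' => stackNum (Function.update S k (f v :: S k) k')) := by
      rw [← update_stackNum]; rfl
    rw [e]
    exact CounterMachine.Passes.head (l := []) (.run v hq)
      (ih _ _ hq fun q' h => stmts_trans h hq)
  | peek k f q ih =>
    have hq := hsub q (by simp [stmts₁, stmts₁_self])
    have e : (loopMachine dec start).step 5 (.run (.peek k f q) v, fun k => stackNum (S k)) =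
        (.run q (f v (S k).head?), fun k => stackNum (S k)) := by
      rw [← ofDigit_stackNum_mod]
      exact Prod.ext rfl (Function.update_eq_self _ _)
    rw [e]
    exact CounterMachine.Passes.head (l := []) (.run _ hq)
      (ih _ _ hq fun q' h => stmts_trans h hq)
  | pop k f q ih =>
    have hq := hsub q (by simp [stmts₁, stmts₁_self])
    have e : (loopMachine dec start).step 5 (.run (.pop k f q) v, fun k => stackNum (S k)) =
        (.run q (f v (S k).head?), fun k' => stackNum (Function.update S k (S k).tail k')) := by
      rw [← ofDigit_stackNum_mod, ← update_stackNum, ← stackNum_div]; rfl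
    rw [e]
    exact CounterMachine.Passes.head (l := []) (.run _ hq)
      (ih _ _ hq fun q' h => stmts_trans h hq)
  | load f q ih =>
    have hq := hsub q (by simp [stmts₁, stmts₁_self])
    have e : (loopMachine dec start).step 5 (.run (.load f q) v, fun k => stackNum (S k)) =
        (.run q (f v), fun k => stackNum (S k)) :=
      Prod.ext rfl (Function.update_eq_self _ _)
    rw [e]
    exact CounterMachine.Passes.head (l := []) (.run _ hq)
      (ih _ _ hq fun q' h => stmts_trans h hq)
  | branch f q₁ q₂ ih₁ ih₂ =>
    have hq₁ := hsub q₁ (by simp [stmts₁, stmts₁_self])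
    have hq₂ := hsub q₂ (by simp [stmts₁, stmts₁_self])
    have e : (loopMachine dec start).step 5
        (.run (.branch f q₁ q₂) v, fun k => stackNum (S k)) =
        (.run (cond (f v) q₁ q₂) v, fun k => stackNum (S k)) :=
      Prod.ext rfl (Function.update_eq_self _ _)
    rw [e, stepAux]
    cases f v
    · exact CounterMachine.Passes.head (l := []) (.run _ hq₂)
        (ih₂ _ _ hq₂ fun q' h => stmts_trans h hq₂)
    · exact CounterMachine.Passes.head (l := []) (.run _ hq₁)
        (ih₁ _ _ hq₁ fun q' h => stmts_trans h hq₁)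
  | goto f =>
    have e : (loopMachine dec start).step 5 (.run (.goto f) v, fun k => stackNum (S k)) =
        toLoop (stepAux (.goto f) v S) :=
      Prod.ext rfl (Function.update_eq_self _ _)
    rw [e]
    exact CounterMachine.Passes.refl _
  | halt =>
    have e : (loopMachine dec start).step 5 (.run .halt v, fun k => stackNum (S k)) =
        toLoop (stepAux .halt v S) :=
      Prod.ext rfl (Function.update_eq_self _ _)
    rw [e]
    exact CounterMachine.Passes.refl _

theorem passes_of_reaches [Inhabited Λ'] (hT : TM2.Supports tr T)
    {c c' : TM2.Cfg (fun _ : K' => Γ') Λ' (Option Γ')}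
    (h : StateTransition.Reaches (TM2.step tr) c c') (hc : c.l ∈ Finset.insertNone T) :
    (loopMachine dec start).Passes 5 {q | LoopState.IsVisited T L q} (toLoop c) []
      (toLoop c') := by
  induction h using Relation.ReflTransGen.head_induction_on with
  | refl => exact CounterMachine.Passes.refl _
  | head h _ ih =>
    refine CounterMachine.Passes.trans (l := []) ?_ (ih (TM2.step_supports tr hT h hc))
    rename_i c₁ c₂ _
    obtain ⟨_ | l, v, S⟩ := c₁
    · exact absurd h (by simp [TM2.step])
    · simp only [TM2.step, Option.mem_def, Option.some.injEq] at h
      subst h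
      refine passes_stepAux _ _ _ ?_
      classical
      exact Finset.some_mem_insertNone.2
        (Finset.mem_biUnion.2 ⟨l, Finset.some_mem_insertNone.1 hc, stmts₁_self⟩)

/-- Popping moves the first entry, in reverse order, from the stack into the state; the bound `L`
keeps the visited states within a finite set. -/
theorem passes_scan (x l rest : List Γ') (hx : ∀ a ∈ x, a ≠ .cons)
    (hl : l.length + x.length ≤ L) :
    (loopMachine dec start).Passes 5 {q | LoopState.IsVisited T L q}
      (.scan l, fun k => stackNum (K'.elim (x ++ .cons :: rest) [] [] [] k)) []
      (.emit (x.reverse ++ l), fun k => stackNum (K'.elim rest [] [] [] k)) := by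
  induction x generalizing l with
  | nil =>
    refine CounterMachine.Passes.head (l := []) (.scan (by simpa using hl)) ?_
    have e : (loopMachine dec start).step 5
        (.scan l, fun k => stackNum (K'.elim ([] ++ .cons :: rest) [] [] [] k)) =
        (.emit ([].reverse ++ l), fun k => stackNum (K'.elim rest [] [] [] k)) := by
      refine Prod.ext ?_ ?_
      · have := ofDigit_stackNum_mod (.cons :: rest)
        simp [CounterMachine.step, loopMachine, this]
      · have := stackNum_div (.cons :: rest)
        simp only [CounterMachine.step, loopMachine, CounterOp.apply, List.nil_append,
          K'.elim_main, this, update_stackNum, K'.elim_update_main, List.tail_cons]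
    rw [e]
    exact CounterMachine.Passes.refl _
  | cons a x ih =>
    refine CounterMachine.Passes.head (l := [])
      (.scan (by simp only [List.length_cons] at hl; omega)) ?_
    have e : (loopMachine dec start).step 5
        (.scan l, fun k => stackNum (K'.elim (a :: x ++ .cons :: rest) [] [] [] k)) =
        (.scan (a :: l), fun k => stackNum (K'.elim (x ++ .cons :: rest) [] [] [] k)) := by
      refine Prod.ext ?_ ?_
      · have := ofDigit_stackNum_mod (a :: x ++ .cons :: rest)
        have ha := hx a (by simp)
        simp only [CounterMachine.step, loopMachine, K'.elim_main, this]
        cases a <;> simp_all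
      · have := stackNum_div (a :: (x ++ .cons :: rest))
        simp only [CounterMachine.step, loopMachine, CounterOp.apply,
          K'.elim_main, this, update_stackNum, K'.elim_update_main, List.tail_cons,
          List.cons_append]
    rw [e]
    have := ih (a :: l) (fun y hy => hx y (by simp [hy]))
      (by simp only [List.length_cons] at hl ⊢; omega)
    simpa using this

/-- Once the first entry is removed, the main stack holds `trList [n + 1]` and the others are empty,
which is exactly the initial configuration for the next input. -/
theorem passes_round (c : ToPartrec.Code) (n m : ℕ) (hc : c.eval [n] = pure [m, n + 1])
    (hL : (trNat m).length ≤ L) (o : O) (ho : dec (trNat m).reverse = some o) :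
    (loopMachine dec (trNormal c .halt)).Passes 5
      {q | LoopState.IsVisited (codeSupp c .halt) L q}
      (toLoop (init c [n])) [o] (toLoop (init c [n + 1])) := by
  let _ : Inhabited Λ' := ⟨trNormal c .halt⟩
  have h : halt [m, n + 1] ∈ StateTransition.eval (TM2.step tr) (init c [n]) := by
    rw [tr_eval, hc]
    exact ⟨trivial, rfl⟩
  have hr := (StateTransition.mem_eval.1 h).1
  have h1 := passes_of_reaches (dec := dec) (start := trNormal c .halt) (L := L)
    (tr_supports c .halt) hr (Finset.some_mem_insertNone.2 (tr_supports c .halt).1)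
  have h2 := passes_scan (dec := dec) (start := trNormal c .halt) (T := codeSupp c .halt) (L := L)
    (trNat m) [] (trList [n + 1])
    (fun a ha h => by subst h; simpa [natEnd] using trNat_natEnd _ _ ha) (by simpa using hL)
  refine h1.trans (h2.trans (l' := [o]) ?_)
  have e : (loopMachine dec (trNormal c .halt)).step 5
      (.emit ((trNat m).reverse ++ []), fun k => stackNum (K'.elim (trList [n + 1]) [] [] [] k)) =
      toLoop (init c [n + 1]) := Prod.ext rfl (Function.update_eq_self _ _)
  have h3 := CounterMachine.Passes.head (M := loopMachine dec (trNormal c .halt)) (b := 5)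
    (F := {q | LoopState.IsVisited (codeSupp c .halt) L q}) (l := [])
    (c := (.emit ((trNat m).reverse ++ []), fun k => stackNum (K'.elim (trList [n + 1]) [] [] [] k)))
    (.emit (by simpa using hL)) (by rw [e]; exact CounterMachine.Passes.refl _)
  simpa [loopMachine, ho] using h3

theorem passes_rounds (c : ToPartrec.Code) (x : ℕ → ℕ) (hc : ∀ n, c.eval [n] = pure [x n, n + 1])
    (hL : ∀ n, (trNat (x n)).length ≤ L) (w : ℕ → O)
    (hw : ∀ n, dec (trNat (x n)).reverse = some (w n)) (n : ℕ) :
    (loopMachine dec (trNormal c .halt)).Passes 5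
      {q | LoopState.IsVisited (codeSupp c .halt) L q}
      (.boot, 0) ((List.range n).map w) (toLoop (init c [n])) := by
  induction n with
  | zero =>
    refine CounterMachine.Passes.head (l := []) .boot ?_
    -- The number `0` has no binary digits, so pushing a single separator writes the list `[0]`.
    have e : (loopMachine dec (trNormal c .halt)).step 5 (.boot, 0) = toLoop (init c [0]) := by
      refine Prod.ext rfl ?_
      funext k
      cases k <;> simp [CounterMachine.step, loopMachine, toLoop, init, CounterOp.apply, stackNum]
    rw [e]
    exact CounterMachine.Passes.refl _
  | succ n ih =>
    rw [List.range_succ, List.map_append]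
    exact ih.trans (passes_round c n (x n) (hc n) (hL n) (w n) (hw n))

end Turing.PartrecToTM2

/-! ### Computable words -/

open Turing Turing.ToPartrec Turing.PartrecToTM2 in
theorem exists_code_pair {x : ℕ → ℕ} (hx : Computable x) :
    ∃ c : ToPartrec.Code, ∀ n, c.eval [n] = pure [x n, n + 1] := by
  obtain ⟨c, hc⟩ := Code.exists_code (Nat.Partrec'.part_iff₁.2 hx.partrec)
  refine ⟨.cons c .succ, fun n => ?_⟩
  have := hc (n ::ᵥ List.Vector.nil)
  simp only [List.Vector.head_cons] at this
  change c.eval [n] = _ at this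
  simp [Code.eval, this]

open Turing.PartrecToTM2 in
theorem mainTheorem2 {A : Type*} [Finite A] [Primcodable A] (w : ℕ → A) (hw : Computable w) :
    ∃ (Γ : Type) (_ : Finite Γ) (ι : A ↪ Γ) (S : PD0LSystem Γ) (u : ℕ → Γ),
      ¬ Function.Surjective ι ∧ S.NonErasing ∧ S.Generates u ∧ SparselyEmbedded ι w u := by
  -- The machine needs its output type in `Type`, so `A` is replaced by `Fin N`.
  obtain ⟨N, ⟨e⟩⟩ := Finite.exists_equiv_fin A
  obtain ⟨c, hc⟩ := exists_code_pair (Computable.encode.comp hw)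
  obtain ⟨L, hL⟩ := (Set.finite_range fun a : A => (trNat (Encodable.encode a)).length).bddAbove
  have hp := passes_rounds (L := L) (O := Fin N)
    (dec := fun l => (Encodable.decode (α := A) (ofBits l.reverse)).map e) c
    (fun n => Encodable.encode (w n)) hc (fun n => hL ⟨w n, rfl⟩) (fun n => e (w n))
    (fun n => by simp [ofBits_trNat])
  set M := loopMachine (fun l => (Encodable.decode (α := A) (ofBits l.reverse)).map e)
    (trNormal c .halt)
  -- A step emits at most one letter, so `n` letters take at least `n` steps; hence the controlled
  -- runs cover all times.
  have key : ∀ n, ∃ t, n ≤ t ∧ M.output 5 (.boot, 0) t = (List.range n).map (fun n => e (w n)) ∧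
      ∀ i < t, ((M.step 5)^[i] (.boot, 0)).1 ∈ {q | LoopState.IsVisited (codeSupp c .halt) L q} :=
    fun n => by
      obtain ⟨t, -, h1, h2⟩ := hp n
      refine ⟨t, ?_, h1, h2⟩
      simpa [h1] using M.length_output_le 5 (.boot, 0) t
  obtain ⟨Γ, hΓ, ι, S, u, h1, h2, h3, f, hf, hr, hfw⟩ := M.exists_pd0l 5 .boot
    (LoopState.finite_isVisited (codeSupp c .halt) L)
    (fun t => by
      obtain ⟨s, hs, -, h⟩ := key (t + 1)
      exact h t hs)
    (fun n => e (w n))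
    (fun t i a h => by
      obtain ⟨s, hs, h', -⟩ := key t
      obtain ⟨d, rfl⟩ := Nat.exists_eq_add_of_le hs
      rw [M.output_add] at h'
      have h2 : ((List.range t).map fun n => e (w n))[i]? = some a := by
        rw [← h', List.getElem?_append_left (List.getElem?_eq_some_iff.1 h).1, h]
      simp only [List.getElem?_map, Option.map_eq_some_iff] at h2
      obtain ⟨j, hj, rfl⟩ := h2
      rw [List.getElem?_eq_some_iff] at hj
      obtain ⟨_, rfl⟩ := hj
      simp)
    (fun n => by
      obtain ⟨t, -, h, -⟩ := key n
      exact ⟨t, by simp [h]⟩)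
  refine ⟨Γ, hΓ, e.toEmbedding.trans ι, S, u, fun h => h1 ?_, h2, h3, f, hf, ?_, hfw⟩
  · exact Function.Surjective.of_comp h
  · rw [hr]
    ext n
    simp only [Set.mem_ofPred_eq, Function.Embedding.coe_trans, Equiv.coe_toEmbedding,
      EquivLike.range_comp]
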